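/- Let $Var$ be a countably infinite set of quantum variables, each of type Boolean (state space $\mathbb{C}^2$ with basis $|0\rangle,|1\rangle$) or integer (state space $\ell^2(\mathbb{Z})$ with basis $|n\rangle$, $n\in\mathbb{Z}$). The state space $\mathcal{H}_{\bar q}$ of a register $\bar q$ (a finite sequence of distinct variables) is the tensor product of the state spaces of its variables. The space $\mathcal{H}_{\rm all}$ of all variables is the Hilbert space whose orthonormal basis is the countable set of product basis vectors $\bigotimes_q |f(q)\rangle$ with $f(q)=0$ for all but finitely many $q$. A bounded operator $A$ on $\mathcal{H}_{\bar q}$ is identified with its cylinder extension $A\otimes I$ on $\mathcal{H}_{\rm all}$. A measurement on $\mathcal{H}_{\bar q}$ is a family $\{M_m\}$ of bounded operators with $\sum_m M_m^\dagger M_m=I$ (strongly); a yes-no measurement has the outcomes $0,1$. Quantum programs are given by $$S::=\mathbf{skip}\mid q:=0\mid \bar q:=U\bar q\mid S_1;S_2\mid \mathbf{measure}\ M[\bar q]:\bar S\mid \mathbf{while}\ M[\bar q]=1\ \mathbf{do}\ S,$$ where $U$ is a bounded operator on $\mathcal{H}_{\bar q}$ with $U^\dagger U=I$, $\bar S=\{S_m\}$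 has one program for each outcome of the measurement $M$, and in the loop $M=\{M_0,M_1\}$ is a yes-no measurement. With $E$ the empty program and $E;S_2=S_2$, the transitions are $\langle\mathbf{skip},\rho\rangle\to\langle E,\rho\rangle$; $\langle q:=0,\rho\rangle\to\langle E,\sum_n|0\rangle_q\langle n|\rho|n\rangle_q\langle 0|\rangle$, the sum running over the basis labels of $q$; $\langle\bar q:=U\bar q,\rho\rangle\to\langle E,U\rho U^\dagger\rangle$; $\langle S_1;S_2,\rho\rangle\to\langle S_1';S_2,\rho'\rangle$ whenever $\langle S_1,\rho\rangle\to\langle S_1',\rho'\rangle$; $\langle\mathbf{measure}\ M[\bar q]:\bar S,\rho\rangle\to\langle S_m,M_m\rho M_m^\dagger\rangle$ for each outcome $m$ (different outcomes count as different transitions); and $\mathbf{while}=\mathbf{while}\ M[\bar q]=1\ \mathbf{do}\ S$ has the two transitions $\langle\mathbf{while},\rho\rangle\to\langle E,M_0\rho M_0^\dagger\rangle$ and $\langle\mathbf{while},\rho\rangle\to\langle S;\mathbf{while},M_1\rho M_1^\dagger\rangle$. The semantic function $[\![S]\!](\rho)$ is the sum of $\rho'$ over all finite transition sequences from $\langle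 S,\rho\rangle$ to $\langle E,\rho'\rangle$, counted with multiplicity. A partial density operator is a positive trace class operator $\rho$ on $\mathcal{H}_{\rm all}$ with $tr(\rho)\le 1$. A quantum predicate is a bounded operator $P$ on $\mathcal{H}_{\rm all}$ with $0\sqsubseteq P\sqsubseteq I$, where $\sqsubseteq$ is the Löwner order. The formula $\{P\}S\{Q\}$ is totally correct if $tr(P\rho)\le tr(Q[\![S]\!](\rho))$ for all partial density operators $\rho$, and partially correct if $tr(P\rho)\le tr(Q[\![S]\!](\rho))+[tr(\rho)-tr([\![S]\!](\rho))]$ for all partial density operators $\rho$. The weakest precondition $wp.S.P$ (respectively the weakest liberal precondition $wlp.S.P$) is the $\sqsubseteq$-greatest quantum predicate $Q$ such that $\{Q\}S\{P\}$ is totally (respectively partially) correct. **Proposition.** For every loop $\mathbf{while}=\mathbf{while}\ M[\bar q]=1\ \mathbf{do}\ S$ and every quantum predicate $P$ on $\mathcal{H}_{\rm all}$, the weakest preconditions and weakest liberal preconditions below exist, and 1. $wp.\mathbf{while}.P=M_0^\dagger PM_0+M_1^\dagger(wp.S.(wp.\mathbf{while}.P))M_1$; 2. $wlp.\mathbf{while}.P=M_0^\dagger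 PM_0+M_1^\dagger(wlp.S.(wlp.\mathbf{while}.P))M_1$. -/

import Mathlib

open scoped lp ENNReal

noncomputable section

namespace QWhile

/-! ### Square-summable families -/

theorem memℓp_two_iff {ι : Type*} (f : ι → ℂ) :
    Memℓp f 2 ↔ Summable fun i => ‖f i‖ ^ 2 := by
  rw [memℓp_gen_iff (by norm_num)]
  simp

theorem hasSum_sq {ι : Type*} (f : ℓ²(ι, ℂ)) : HasSum (fun i => ‖f i‖ ^ 2) (‖f‖ ^ 2) := by
  have h := lp.hasSum_norm (p := 2) (by norm_num) f
  simpa using h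

/-- The element of the computational basis of `ℓ²(ι)` labelled by `i`. -/
def ket {ι : Type*} (i : ι) : ℓ²(ι, ℂ) :=
  letI := Classical.decEq ι
  lp.single 2 i (1 : ℂ)

/-- The operator `|x⟩⟨y|`. -/
def ketbra {ι : Type*} (x y : ι) : ℓ²(ι, ℂ) →L[ℂ] ℓ²(ι, ℂ) :=
  (innerSL ℂ (ket y)).smulRight (ket x)

/-- The trace, computed in the computational basis. -/
def trace {ι : Type*} (A : ℓ²(ι, ℂ) →L[ℂ] ℓ²(ι, ℂ)) : ℂ :=
  ∑' i, inner ℂ (ket i) (A (ket i))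

/-- Partial density operators: positive trace class operators of trace at most one. (For a positive
operator, summability of the diagonal in one orthonormal basis is the same as summability, with
the same sum, in every orthonormal basis.) -/
def IsPartialDensity {ι : Type*} (ρ : ℓ²(ι, ℂ) →L[ℂ] ℓ²(ι, ℂ)) : Prop :=
  ρ.IsPositive ∧ Summable (fun i => inner ℂ (ket i) (ρ (ket i))) ∧ (trace ρ).re ≤ 1

/-- Quantum predicates: `0 ⊑ P ⊑ I` in the Löwner order (Mathlib's order on operators). -/
def IsPredicate {ι : Type*} (P : ℓ²(ι, ℂ) →L[ℂ] ℓ²(ι, ℂ)) : Prop :=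
  0 ≤ P ∧ P ≤ 1

/-! ### Types, variables, state spaces -/

/-- The two basic types of quantum variables. -/
inductive QType
  | boolean
  | integer

/-- The labels of the computational basis of the state space of a type. -/
def QType.Val : QType → Type
  | .boolean => Fin 2
  | .integer => ℤ

instance (t : QType) : Zero t.Val :=
  match t with
  | .boolean => inferInstanceAs (Zero (Fin 2))
  | .integer => inferInstanceAs (Zero ℤ)

/-- A quantum register: a finite sequence of distinct variables. -/
structure Register (Var : Type) where
  vars : List Var
  nodup : vars.Nodup

variable {Var : Type}

/-- The register consisting of one variable. -/
def Register.single (v : Var) : Register Var := ⟨[v], List.nodup_singleton v⟩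

/-- Labels of the product basis of the state space of a register. -/
abbrev RegBasis (ty : Var → QType) (q : Register Var) : Type :=
  ∀ v : {v // v ∈ q.vars}, (ty v.1).Val

/-- The state space of a register: the tensor product of the state spaces of its variables,
i.e. the Hilbert space with the product vectors of basis vectors as orthonormal basis. -/
abbrev RegSpace (ty : Var → QType) (q : Register Var) : Type := ℓ²(RegBasis ty q, ℂ)

/-- Labels of the product basis of the space of all variables: a basis label for every variable,
all but finitely many of them being `0`. This set is countable when `Var` is. -/
def AllBasis (ty : Var → QType) : Type :=
  {f : ∀ v, (ty v).Val // {v | f v ≠ 0}.Finite}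

/-- The state space of all variables. -/
abbrev AllSpace (ty : Var → QType) : Type := ℓ²(AllBasis ty, ℂ)

/-- Bounded operators on the state space of a register. -/
abbrev RegOp (ty : Var → QType) (q : Register Var) : Type := RegSpace ty q →L[ℂ] RegSpace ty q

/-- Bounded operators on the state space of all variables. -/
abbrev AllOp (ty : Var → QType) : Type := AllSpace ty →L[ℂ] AllSpace ty

/-! ### Cylinder extension -/

section Cylinder

variable {ty : Var → QType} (q : Register Var)

/-- The values of the variables of the register. -/
def restrict (f : AllBasis ty) : RegBasis ty q := fun v => f.1 v.1

open Classical in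
/-- Overwrite the values of the variables of the register. -/
def overwrite (x : RegBasis ty q) (f : AllBasis ty) : AllBasis ty :=
  ⟨fun v => if h : v ∈ q.vars then x ⟨v, h⟩ else f.1 v, by
    refine (f.2.union q.vars.finite_toSet).subset fun v hv => ?_
    by_cases h : v ∈ q.vars
    · exact Or.inr h
    · left
      simpa [h] using hv⟩

theorem restrict_overwrite (x : RegBasis ty q) (f : AllBasis ty) :
    restrict q (overwrite q x f) = x := by
  funext v
  simp [restrict, overwrite, v.2]

theorem overwrite_overwrite (x y : RegBasis ty q) (f : AllBasis ty) :
    overwrite q x (overwrite q y f) = overwrite q x f := by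
  apply Subtype.ext
  funext v
  by_cases h : v ∈ q.vars <;> simp [overwrite, h]

theorem overwrite_restrict (f : AllBasis ty) : overwrite q (restrict q f) f = f := by
  apply Subtype.ext
  funext v
  simp [restrict, overwrite]

/-- A basis label is a pair of a label for the variables outside the register and one for those
in the register. -/
def splitEquiv : {r : AllBasis ty // restrict q r = 0} × RegBasis ty q ≃ AllBasis ty where
  toFun p := overwrite q p.2 p.1.1
  invFun f := (⟨overwrite q 0 f, restrict_overwrite q 0 f⟩, restrict q f)
  left_inv := by
    rintro ⟨⟨r, hr⟩, x⟩
    refine Prod.ext (Subtype.ext ?_) (restrict_overwrite q x r)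
    have h := overwrite_restrict q r
    rw [hr] at h
    simpa [overwrite_overwrite] using h
  right_inv f := by simp [overwrite_overwrite, overwrite_restrict]

theorem summable_split (ψ : AllSpace ty) :
    HasSum (fun p => ‖ψ (splitEquiv q p)‖ ^ 2) (‖ψ‖ ^ 2) :=
  (splitEquiv q).hasSum_iff.mpr (hasSum_sq ψ)

theorem overwrite_injective (f : AllBasis ty) : Function.Injective fun x => overwrite q x f :=
  fun x y h => by
    have := congrArg (restrict q) h
    simpa [restrict_overwrite] using this

/-- The vector `x ↦ ψ (overwrite q x f)` of the register space: `ψ` with the variables outside the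
register frozen at their values in `f`. -/
def slice (f : AllBasis ty) : AllSpace ty →ₗ[ℂ] RegSpace ty q where
  toFun ψ := ⟨fun x => ψ (overwrite q x f), (memℓp_two_iff _).mpr
    ((hasSum_sq ψ).summable.comp_injective (overwrite_injective q f))⟩
  map_add' _ _ := rfl
  map_smul' _ _ := rfl

theorem slice_apply (f : AllBasis ty) (ψ : AllSpace ty) (x : RegBasis ty q) :
    slice q f ψ x = ψ (overwrite q x f) := rfl

theorem slice_overwrite (x : RegBasis ty q) (f : AllBasis ty) (ψ : AllSpace ty) :
    slice q (overwrite q x f) ψ = slice q f ψ := by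
  apply lp.ext
  funext y
  simp [slice_apply, overwrite_overwrite]

theorem hasSum_slice (ψ : AllSpace ty) :
    HasSum (fun r : {r : AllBasis ty // restrict q r = 0} => ‖slice q r.1 ψ‖ ^ 2) (‖ψ‖ ^ 2) :=
  (summable_split q ψ).prod_fiberwise fun r => hasSum_sq (slice q r.1 ψ)

theorem cylinder_hasSum (A : RegOp ty q) (ψ : AllSpace ty) :
    ∃ s ≤ (‖A‖ * ‖ψ‖) ^ 2,
      HasSum (fun f : AllBasis ty => ‖A (slice q f ψ) (restrict q f)‖ ^ 2) s := by
  have hle (r : {r : AllBasis ty // restrict q r = 0}) :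
      ‖A (slice q r.1 ψ)‖ ^ 2 ≤ ‖A‖ ^ 2 * ‖slice q r.1 ψ‖ ^ 2 := by
    rw [← mul_pow]
    gcongr
    exact A.le_opNorm _
  have hr := (hasSum_slice q ψ).mul_left (‖A‖ ^ 2)
  have hsum : Summable fun r : {r : AllBasis ty // restrict q r = 0} =>
      ‖A (slice q r.1 ψ)‖ ^ 2 :=
    Summable.of_nonneg_of_le (fun _ => by positivity) hle hr.summable
  have hfib (r : {r : AllBasis ty // restrict q r = 0}) :
      HasSum (fun x => ‖A (slice q r.1 ψ) x‖ ^ 2) (‖A (slice q r.1 ψ)‖ ^ 2) := hasSum_sq _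
  have hprod : Summable fun p : {r : AllBasis ty // restrict q r = 0} × RegBasis ty q =>
      ‖A (slice q p.1.1 ψ) p.2‖ ^ 2 := by
    refine (summable_prod_of_nonneg fun _ => by positivity).mpr ⟨fun r => (hfib r).summable, ?_⟩
    simpa only [(hfib _).tsum_eq] using hsum
  have hs := hprod.hasSum.prod_fiberwise hfib
  refine ⟨_, ?_, (splitEquiv q).hasSum_iff.mp (by
    simpa [Function.comp_def, splitEquiv, slice_overwrite, restrict_overwrite]
      using hprod.hasSum)⟩
  rw [mul_pow]
  exact hasSum_le hle hs hr

/-- The cylinder extension of `A`, as a linear map. -/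
def cylinderLinear (A : RegOp ty q) : AllSpace ty →ₗ[ℂ] AllSpace ty where
  toFun ψ := ⟨fun f => A (slice q f ψ) (restrict q f),
    (memℓp_two_iff _).mpr (cylinder_hasSum q A ψ).choose_spec.2.summable⟩
  map_add' ψ φ := by
    apply lp.ext
    funext f
    change A (slice q f (ψ + φ)) (restrict q f) = _
    rw [map_add, map_add]
    rfl
  map_smul' c ψ := by
    apply lp.ext
    funext f
    change A (slice q f (c • ψ)) (restrict q f) = _
    rw [map_smul, map_smul]
    rfl

theorem norm_cylinderLinear_le (A : RegOp ty q) (ψ : AllSpace ty) :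
    ‖cylinderLinear q A ψ‖ ≤ ‖A‖ * ‖ψ‖ := by
  obtain ⟨s, hs, h⟩ := cylinder_hasSum q A ψ
  have h' := (hasSum_sq (cylinderLinear q A ψ)).unique h
  exact (sq_le_sq₀ (norm_nonneg _) (by positivity)).mp (h'.trans_le hs)

/-- The cylinder extension `A ⊗ I` of an operator on the state space of a register: `A` acts on
the variables of the register while the other variables are kept fixed. -/
def cylinder (A : RegOp ty q) : AllOp ty :=
  (cylinderLinear q A).mkContinuous ‖A‖ (norm_cylinderLinear_le q A)

end Cylinder

/-! ### Quantum programs -/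

/-- Quantum measurements on a register: `∑ₘ Mₘ† Mₘ = I`, the sum being taken in the strong operator
topology. -/
structure Measurement (ty : Var → QType) (q : Register Var) (ι : Type) where
  op : ι → RegOp ty q
  complete : ∀ ψ, HasSum (fun m => (op m).adjoint (op m ψ)) ψ

/-- Quantum while-programs. In `apply q U` the operator satisfies `U† U = I`. -/
inductive Program (ty : Var → QType) : Type 1
  | skip
  | init (v : Var)
  | apply (q : Register Var) (U : RegOp ty q) (hU : U.adjoint * U = 1)
  | seq (S₁ S₂ : Program ty)
  | measure (q : Register Var) {ι : Type} (M : Measurement ty q ι) (S : ι → Program ty)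
  | loop (q : Register Var) (M : Measurement ty q (Fin 2)) (S : Program ty)

/-! ### Operational and denotational semantics -/

variable {ty : Var → QType}

/-- The state after `v := 0`, namely `∑ₙ |0⟩ᵥ⟨n| ρ |n⟩ᵥ⟨0|`. -/
def initState (v : Var) (ρ : AllOp ty) : AllOp ty :=
  ∑' n : RegBasis ty (Register.single v),
    cylinder (Register.single v) (ketbra 0 n) * ρ * cylinder (Register.single v) (ketbra n 0)

/-- The remaining program `S; S₂`, where `none` is the empty program `E` and `E; S₂ = S₂`. -/
def andThen : Option (Program ty) → Program ty → Option (Program ty)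
  | none, S₂ => some S₂
  | some S₁, S₂ => some (.seq S₁ S₂)

/-- `Step S ρ S' ρ'` is the type of transitions `⟨S, ρ⟩ → ⟨S', ρ'⟩`, where `none` is the empty
program. Different measurement outcomes are different transitions, even when they lead to the
same configuration. -/
inductive Step : Option (Program ty) → AllOp ty → Option (Program ty) → AllOp ty → Type 1
  | skip (ρ : AllOp ty) : Step (some .skip) ρ none ρ
  | init (v : Var) (ρ : AllOp ty) : Step (some (.init v)) ρ none (initState v ρ)
  | apply (q : Register Var) (U : RegOp ty q) (hU : U.adjoint * U = 1) (ρ : AllOp ty) :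
      Step (some (.apply q U hU)) ρ none (cylinder q U * ρ * (cylinder q U).adjoint)
  | seq (S₁ S₂ : Program ty) (S₁' : Option (Program ty)) (ρ ρ' : AllOp ty)
      (h : Step (some S₁) ρ S₁' ρ') : Step (some (.seq S₁ S₂)) ρ (andThen S₁' S₂) ρ'
  | measure (q : Register Var) {ι : Type} (M : Measurement ty q ι) (S : ι → Program ty)
      (m : ι) (ρ : AllOp ty) :
      Step (some (.measure q M S)) ρ (some (S m))
        (cylinder q (M.op m) * ρ * (cylinder q (M.op m)).adjoint)
  | loop_zero (q : Register Var) (M : Measurement ty q (Fin 2)) (S : Program ty) (ρ : AllOp ty) :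
      Step (some (.loop q M S)) ρ none
        (cylinder q (M.op 0) * ρ * (cylinder q (M.op 0)).adjoint)
  | loop_one (q : Register Var) (M : Measurement ty q (Fin 2)) (S : Program ty) (ρ : AllOp ty) :
      Step (some (.loop q M S)) ρ (some (.seq S (.loop q M S)))
        (cylinder q (M.op 1) * ρ * (cylinder q (M.op 1)).adjoint)

/-- `Run S ρ S' ρ'` is the type of finite transition sequences from `⟨S, ρ⟩` to `⟨S', ρ'⟩`. -/
inductive Run : Option (Program ty) → AllOp ty → Option (Program ty) → AllOp ty → Type 1
  | refl (S : Option (Program ty)) (ρ : AllOp ty) : Run S ρ S ρ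
  | cons {S S' S'' : Option (Program ty)} {ρ ρ' ρ'' : AllOp ty}
      (h : Step S ρ S' ρ') (t : Run S' ρ' S'' ρ'') : Run S ρ S'' ρ''

/-- The semantic function `⟦S⟧`: the sum of the multiset of results `ρ'` of all terminating
computations `⟨S, ρ⟩ →* ⟨E, ρ'⟩`. -/
def denote (S : Program ty) (ρ : AllOp ty) : AllOp ty :=
  ∑' c : (ρ' : AllOp ty) × Run (some S) ρ none ρ', c.1

/-! ### Correctness and weakest preconditions -/

/-- `{P} S {Q}` is true in the sense of total correctness. -/
def TotallyCorrect (P : AllOp ty) (S : Program ty) (Q : AllOp ty) : Prop :=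
  ∀ ρ : AllOp ty, IsPartialDensity ρ → (trace (P * ρ)).re ≤ (trace (Q * denote S ρ)).re

/-- `{P} S {Q}` is true in the sense of partial correctness. -/
def PartiallyCorrect (P : AllOp ty) (S : Program ty) (Q : AllOp ty) : Prop :=
  ∀ ρ : AllOp ty, IsPartialDensity ρ →
    (trace (P * ρ)).re ≤
      (trace (Q * denote S ρ)).re + ((trace ρ).re - (trace (denote S ρ)).re)

/-- `W` is the weakest precondition of `S` with respect to `P`. -/
def IsWeakestPre (S : Program ty) (P W : AllOp ty) : Prop :=
  IsGreatest {Q : AllOp ty | IsPredicate Q ∧ TotallyCorrect Q S P} W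

/-- `W` is the weakest liberal precondition of `S` with respect to `P`. -/
def IsWeakestLiberalPre (S : Program ty) (P W : AllOp ty) : Prop :=
  IsGreatest {Q : AllOp ty | IsPredicate Q ∧ PartiallyCorrect Q S P} W

/-- The weakest precondition `wp.S.P`, the unique `W` with `IsWeakestPre S P W` (if there were
none, an unspecified operator). -/
def wp (S : Program ty) (P : AllOp ty) : AllOp ty := Classical.epsilon (IsWeakestPre S P)

/-- The weakest liberal precondition `wlp.S.P`, the unique `W` with `IsWeakestLiberalPre S P W`
(if there were none, an unspecified operator). -/
def wlp (S : Program ty) (P : AllOp ty) : AllOp ty := Classical.epsilon (IsWeakestLiberalPre S P)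

end QWhile

end

noncomputable section

namespace QWhile

open scoped ComplexOrder

/-! Write `⟦S⟧` for `denote S`. On positive trace class operators it is a quantum operation: it does
not increase the trace, and it has a Heisenberg dual `S*` with tr(A⟦S⟧ρ) = tr(S*(A)ρ) for all A ≥ 0
(`isOperation_denote`). Rank one states separate positive operators (`le_of_val_le`), so wp.S.P =
S*(P). Partial correctness of {Q}S{P} rearranges to tr((1-P)⟦S⟧ρ) ≤ tr((1-Q)ρ), so wlp.S.P = 1 -
wp.S.(1-P). Splitting the computations of the loop at their first transition gives ⟦while⟧ρ = M₀ρM₀†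
+ ⟦while⟧(⟦S⟧(M₁ρM₁†)), tested against every A ≥ 0 (`val_denote_loop`). Dualizing is the equation
for wp; taking complements with M₀†M₀ + M₁†M₁ = 1 gives the one for wlp. No approximation of the
loop by its iterates is needed. Computations are indexed by state-independent paths of branches, so
⟦S⟧ becomes a sum of operations over a fixed set, of total trace at most tr ρ (`tsum_path_le`).
Traces take values in `ℝ≥0∞`, where sums can always be exchanged. -/

theorem enorm_sq_eq_ofReal {E : Type*} [SeminormedAddCommGroup E] (x : E) :
    ‖x‖ₑ ^ 2 = ENNReal.ofReal (‖x‖ ^ 2) := by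
  rw [ENNReal.ofReal_pow (norm_nonneg _), ofReal_norm]

theorem summable_norm_sq {α E : Type*} [SeminormedAddCommGroup E] {f : α → E}
    (h : ∑' a, ‖f a‖ₑ ^ 2 ≠ ∞) : Summable fun a => ‖f a‖ ^ 2 := by
  simpa using ENNReal.summable_toReal h

theorem tsum_enorm_sq {α E : Type*} [SeminormedAddCommGroup E] {f : α → E} {c : ℝ}
    (h : HasSum (fun a => ‖f a‖ ^ 2) c) : ∑' a, ‖f a‖ₑ ^ 2 = ENNReal.ofReal c := by
  simp_rw [enorm_sq_eq_ofReal, ← h.tsum_eq]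
  exact (ENNReal.ofReal_tsum_of_nonneg (fun _ => by positivity) h.summable).symm

/-! ### Positive operators -/

section Positive

variable {H : Type*} [NormedAddCommGroup H] [InnerProductSpace ℂ H]

theorem adjoint_of_nonneg [CompleteSpace H] {A : H →L[ℂ] H} (hA : 0 ≤ A) : A.adjoint = A :=
  ((ContinuousLinearMap.nonneg_iff_isPositive A).mp hA).isSelfAdjoint

theorem exists_sq_eq [CompleteSpace H] {A : H →L[ℂ] H} (hA : 0 ≤ A) :
    ∃ R : H →L[ℂ] H, R.adjoint = R ∧ R * R = A :=
  ⟨CFC.sqrt A, adjoint_of_nonneg (CFC.sqrt_nonneg A), CFC.sqrt_mul_sqrt_self A hA⟩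

theorem adjoint_mul_self_nonneg [CompleteSpace H] (X : H →L[ℂ] H) :
    0 ≤ X.adjoint * X :=
  star_mul_self_nonneg X

theorem conj_nonneg [CompleteSpace H] {A : H →L[ℂ] H} (hA : 0 ≤ A) (X : H →L[ℂ] H) :
    0 ≤ X.adjoint * A * X :=
  star_left_conjugate_nonneg hA X

/-- The quadratic form of a positive operator. -/
def qf (A : H →L[ℂ] H) (ψ : H) : ℝ≥0∞ := ENNReal.ofReal (inner ℂ ψ (A ψ)).re

theorem inner_nonneg {A : H →L[ℂ] H} (hA : 0 ≤ A) (ψ : H) : 0 ≤ inner ℂ ψ (A ψ) :=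
  ((ContinuousLinearMap.nonneg_iff_isPositive A).mp hA).inner_nonneg_right ψ

theorem re_inner_nonneg {A : H →L[ℂ] H} (hA : 0 ≤ A) (ψ : H) : 0 ≤ (inner ℂ ψ (A ψ)).re :=
  (Complex.nonneg_iff.mp (inner_nonneg hA ψ)).1

theorem qf_adjoint_mul_self [CompleteSpace H] (X : H →L[ℂ] H) (ψ : H) :
    qf (X.adjoint * X) ψ = ‖X ψ‖ₑ ^ 2 := by
  rw [qf, enorm_sq_eq_ofReal, mul_apply_eq_comp,
    ContinuousLinearMap.adjoint_inner_right]
  congr 1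
  exact inner_self_eq_norm_sq (𝕜 := ℂ) (X ψ)

theorem qf_one (ψ : H) : qf (1 : H →L[ℂ] H) ψ = ‖ψ‖ₑ ^ 2 := by
  rw [qf, enorm_sq_eq_ofReal]
  congr 1
  exact inner_self_eq_norm_sq (𝕜 := ℂ) ψ

/-- `ENNReal.ofReal` cuts negative values to 0; positivity of `B` is what lets the real inequality
be recovered. -/
theorem le_of_qf_le [CompleteSpace H] {A B : H →L[ℂ] H} (hA : 0 ≤ A) (hB : 0 ≤ B)
    (h : ∀ ψ, qf A ψ ≤ qf B ψ) : A ≤ B := by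
  rw [ContinuousLinearMap.le_def, ContinuousLinearMap.isPositive_iff_complex]
  intro ψ
  have hs : (B - A).adjoint = B - A := by
    rw [map_sub, adjoint_of_nonneg hA, adjoint_of_nonneg hB]
  have h1 : inner ℂ ((B - A) ψ) ψ = inner ℂ ψ (B ψ) - inner ℂ ψ (A ψ) := by
    rw [← ContinuousLinearMap.adjoint_inner_right, hs, sub_apply,
      inner_sub_right]
  have h2 := (ENNReal.ofReal_le_ofReal_iff (re_inner_nonneg hB ψ)).mp (h ψ)
  have h3 := Complex.nonneg_iff.mp (inner_nonneg hA ψ)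
  have h4 := Complex.nonneg_iff.mp (inner_nonneg hB ψ)
  rw [h1]
  refine ⟨Complex.ext rfl ?_, ?_⟩
  · simp [← h3.2, ← h4.2]
  · simpa using h2

theorem qf_le_of_le [CompleteSpace H] {A B : H →L[ℂ] H} (h : A ≤ B) (ψ : H) : qf A ψ ≤ qf B ψ := by
  have := re_inner_nonneg (sub_nonneg.mpr h) ψ
  rw [sub_apply, inner_sub_right, Complex.sub_re] at this
  exact ENNReal.ofReal_le_ofReal (by linarith)

theorem eq_of_qf_eq [CompleteSpace H] {A B : H →L[ℂ] H} (hA : 0 ≤ A) (hB : 0 ≤ B)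
    (h : ∀ ψ, qf A ψ = qf B ψ) : A = B :=
  le_antisymm (le_of_qf_le hA hB fun ψ => (h ψ).le) (le_of_qf_le hB hA fun ψ => (h ψ).ge)

theorem qf_add {A B : H →L[ℂ] H} (hA : 0 ≤ A) (hB : 0 ≤ B) (ψ : H) :
    qf (A + B) ψ = qf A ψ + qf B ψ := by
  rw [qf, add_apply, inner_add_right, Complex.add_re,
    ENNReal.ofReal_add (re_inner_nonneg hA ψ) (re_inner_nonneg hB ψ)]
  rfl

end Positive

/-! ### Hilbert–Schmidt operators and the trace -/

section Operators

variable {ι : Type*}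

/-- Bounded operators on `ℓ²(ι)`. -/
abbrev Op (ι : Type*) : Type _ := ℓ²(ι, ℂ) →L[ℂ] ℓ²(ι, ℂ)

theorem inner_ket (i : ι) (ψ : ℓ²(ι, ℂ)) : inner ℂ (ket i) ψ = ψ i := by
  classical
  simp [ket, lp.inner_single_left]

theorem tsum_enorm_sq_apply (ψ : ℓ²(ι, ℂ)) : ∑' i, ‖ψ i‖ₑ ^ 2 = ‖ψ‖ₑ ^ 2 := by
  rw [tsum_enorm_sq (hasSum_sq ψ), enorm_sq_eq_ofReal]

theorem adjoint_apply_ket (X : Op ι) (i j : ι) :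
    X.adjoint (ket i) j = starRingEnd ℂ (X (ket j) i) := by
  rw [← inner_ket, ← inner_ket, ContinuousLinearMap.adjoint_inner_right, inner_conj_symm]

/-- The square of the Hilbert–Schmidt norm. -/
def hs (X : Op ι) : ℝ≥0∞ := ∑' i, ‖X (ket i)‖ₑ ^ 2

/-- Both sides sum the squared moduli of all matrix entries, by columns or by rows. -/
theorem hs_adjoint (X : Op ι) : hs X.adjoint = hs X := by
  unfold hs
  simp_rw [← tsum_enorm_sq_apply (X _), ← tsum_enorm_sq_apply (X.adjoint _), adjoint_apply_ket]
  rw [ENNReal.tsum_comm]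
  simp [← ofReal_norm]

theorem hs_mul_le (A X : Op ι) : hs (A * X) ≤ ‖A‖ₑ ^ 2 * hs X := by
  unfold hs
  rw [← ENNReal.tsum_mul_left]
  refine ENNReal.tsum_le_tsum fun i => ?_
  rw [← mul_pow]
  gcongr
  exact A.le_opENorm _

theorem hs_mul_ne_top (A : Op ι) {X : Op ι} (hX : hs X ≠ ∞) : hs (A * X) ≠ ∞ :=
  ne_top_of_le_ne_top (ENNReal.mul_ne_top (by simp) hX) (hs_mul_le A X)

theorem hs_mul_ne_top' {X : Op ι} (A : Op ι) (hX : hs X ≠ ∞) : hs (X * A) ≠ ∞ := by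
  rw [← hs_adjoint] at hX ⊢
  rw [← ContinuousLinearMap.star_eq_adjoint, star_mul]
  exact hs_mul_ne_top _ hX

/-- The coordinates of Xψ are ⟨X†eᵢ, ψ⟩; Cauchy–Schwarz bounds each by ‖X†eᵢ‖‖ψ‖. -/
theorem enorm_sq_le_hs (X : Op ι) : ‖X‖ₑ ^ 2 ≤ hs X := by
  by_cases hX : hs X = ∞
  · simp [hX]
  have key (ψ : ℓ²(ι, ℂ)) : ‖X ψ‖ₑ ^ 2 ≤ hs X * ‖ψ‖ₑ ^ 2 := by
    rw [← hs_adjoint, ← tsum_enorm_sq_apply (X ψ), hs, ← ENNReal.tsum_mul_right]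
    refine ENNReal.tsum_le_tsum fun i => ?_
    rw [← inner_ket, ← ContinuousLinearMap.adjoint_inner_left, ← mul_pow]
    gcongr
    rw [← ofReal_norm, ← ofReal_norm, ← ofReal_norm, ← ENNReal.ofReal_mul (norm_nonneg _)]
    exact ENNReal.ofReal_le_ofReal (norm_inner_le_norm _ _)
  have h : ‖X‖ ≤ √(hs X).toReal := by
    refine X.opNorm_le_bound (Real.sqrt_nonneg _) fun ψ => ?_
    refine le_of_sq_le_sq ?_ (by positivity)
    rw [mul_pow, Real.sq_sqrt ENNReal.toReal_nonneg]
    have := ENNReal.toReal_mono (ENNReal.mul_ne_top hX (by simp)) (key ψ)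
    simpa using this
  rw [enorm_sq_eq_ofReal]
  refine ENNReal.ofReal_le_of_le_toReal ?_
  calc ‖X‖ ^ 2 ≤ √(hs X).toReal ^ 2 := by gcongr
    _ = _ := Real.sq_sqrt ENNReal.toReal_nonneg

theorem hasSum_inner_mul (X Y : Op ι) (i : ι) :
    HasSum (fun j => X (ket j) i * Y (ket i) j) (inner ℂ (ket i) ((X * Y) (ket i))) := by
  have h := lp.hasSum_inner (𝕜 := ℂ) (X.adjoint (ket i)) (Y (ket i))
  rw [ContinuousLinearMap.adjoint_inner_left] at h
  refine h.congr_fun fun j => ?_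
  rw [adjoint_apply_ket, RCLike.inner_apply, RCLike.conj_conj, mul_comm]

/-- By |xy| ≤ |x|² + |y|² the double series converges absolutely, which is what cyclicity of the
trace requires. -/
theorem summable_mul_entries {X Y : Op ι} (hX : hs X ≠ ∞) (hY : hs Y ≠ ∞) :
    Summable fun p : ι × ι => X (ket p.2) p.1 * Y (ket p.1) p.2 := by
  have h1 : Summable fun p : ι × ι => ‖X (ket p.2) p.1‖ ^ 2 := by
    apply summable_norm_sq
    rw [ENNReal.tsum_prod (f := fun i j => ‖X (ket j) i‖ₑ ^ 2), ENNReal.tsum_comm]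
    simpa [tsum_enorm_sq_apply, hs] using hX
  have h2 : Summable fun p : ι × ι => ‖Y (ket p.1) p.2‖ ^ 2 := by
    apply summable_norm_sq
    rw [ENNReal.tsum_prod (f := fun i j => ‖Y (ket i) j‖ₑ ^ 2)]
    simpa [tsum_enorm_sq_apply, hs] using hY
  refine Summable.of_norm_bounded (h1.add h2) fun p => ?_
  rw [norm_mul]
  nlinarith [sq_nonneg (‖X (ket p.2) p.1‖ - ‖Y (ket p.1) p.2‖), sq_nonneg ‖X (ket p.2) p.1‖,
    sq_nonneg ‖Y (ket p.1) p.2‖]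

theorem summable_trace_mul {X Y : Op ι} (hX : hs X ≠ ∞) (hY : hs Y ≠ ∞) :
    Summable fun i => inner ℂ (ket i) ((X * Y) (ket i)) := by
  have h := (summable_mul_entries hX hY).prod
  simpa only [(hasSum_inner_mul X Y _).tsum_eq] using h

theorem trace_mul_comm {X Y : Op ι} (hX : hs X ≠ ∞) (hY : hs Y ≠ ∞) :
    trace (X * Y) = trace (Y * X) := by
  unfold trace
  simp_rw [← (hasSum_inner_mul _ _ _).tsum_eq]
  refine (Summable.tsum_comm (f := fun i j => X (ket j) i * Y (ket i) j)
    (summable_mul_entries hX hY)).symm.trans ?_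
  exact tsum_congr fun j => tsum_congr fun i => mul_comm _ _

/-! ### Positive trace class operators -/

/-- Positive trace class operators. -/
def IsPosTraceClass (ρ : Op ι) : Prop := 0 ≤ ρ ∧ ∑' i, qf ρ (ket i) ≠ ∞

theorem isPosTraceClass_iff {ρ : Op ι} : IsPosTraceClass ρ ↔
    ρ.IsPositive ∧ Summable fun i => inner ℂ (ket i) (ρ (ket i)) := by
  rw [IsPosTraceClass, ContinuousLinearMap.nonneg_iff_isPositive]
  refine and_congr_right fun hρ => ?_
  have hρ' := (ContinuousLinearMap.nonneg_iff_isPositive ρ).mpr hρ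
  have hre (i : ι) : (((inner ℂ (ket i) (ρ (ket i))).re : ℝ) : ℂ) = inner ℂ (ket i) (ρ (ket i)) :=
    Complex.ext rfl (Complex.nonneg_iff.mp (inner_nonneg hρ' _)).2
  rw [← summable_congr hre, Complex.summable_ofReal]
  refine ⟨fun h => ?_, fun h => ?_⟩
  · simpa [qf, ENNReal.toReal_ofReal, re_inner_nonneg hρ'] using ENNReal.summable_toReal h
  · simp only [qf]
    rw [← ENNReal.ofReal_tsum_of_nonneg (fun i => re_inner_nonneg hρ' _) h]
    exact ENNReal.ofReal_ne_top

/-- The trace `tr(A ρ)` as an extended nonnegative real, for positive `A` and positive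
trace class `ρ`. -/
def val (A ρ : Op ι) : ℝ≥0∞ := ENNReal.ofReal (trace (A * ρ)).re

theorem ofReal_trace {ρ : Op ι} (hρ : IsPosTraceClass ρ) :
    ENNReal.ofReal (trace ρ).re = ∑' i, qf ρ (ket i) := by
  have hs := (isPosTraceClass_iff.mp hρ).2
  rw [trace, Complex.re_tsum hs,
    ENNReal.ofReal_tsum_of_nonneg (fun i => re_inner_nonneg hρ.1 _)
      (Complex.hasSum_re hs.hasSum).summable]
  rfl

theorem re_trace_nonneg {ρ : Op ι} (hρ : IsPosTraceClass ρ) : 0 ≤ (trace ρ).re := by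
  rw [trace, Complex.re_tsum (isPosTraceClass_iff.mp hρ).2]
  exact tsum_nonneg fun i => re_inner_nonneg hρ.1 _

/-- For σ = √ρ the sum of the ‖σeᵢ‖² is tr ρ. Factoring ρ into two Hilbert–Schmidt operators reduces
all trace identities to `trace_mul_comm`. -/
theorem IsPosTraceClass.exists_sqrt {ρ : Op ι} (hρ : IsPosTraceClass ρ) :
    ∃ σ : Op ι, σ.adjoint = σ ∧ σ * σ = ρ ∧ hs σ ≠ ∞ := by
  obtain ⟨σ, h1, h2⟩ := exists_sq_eq hρ.1
  refine ⟨σ, h1, h2, ?_⟩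
  have := hρ.2
  nth_rw 1 [← h2, ← h1] at this
  simpa only [qf_adjoint_mul_self, hs] using this

theorem isPosTraceClass_adjoint_mul_self {X : Op ι} (hX : hs X ≠ ∞) :
    IsPosTraceClass (X.adjoint * X) :=
  ⟨adjoint_mul_self_nonneg X, by simpa only [qf_adjoint_mul_self, hs] using hX⟩

theorem IsPosTraceClass.conj {ρ : Op ι} (hρ : IsPosTraceClass ρ) (K : Op ι) :
    IsPosTraceClass (K * ρ * K.adjoint) := by
  obtain ⟨σ, h1, h2, h3⟩ := hρ.exists_sqrt
  have h := isPosTraceClass_adjoint_mul_self (hs_mul_ne_top' K.adjoint h3)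
  simp only [← ContinuousLinearMap.star_eq_adjoint] at h h1 ⊢
  rw [star_mul, star_star, h1, mul_assoc, ← mul_assoc σ, h2, ← mul_assoc] at h
  exact h

/-- With ρ = σσ, both sides are cyclic rearrangements of tr(σK†AKσ). -/
theorem trace_conj (A K : Op ι) {ρ : Op ι} (hρ : IsPosTraceClass ρ) :
    trace (A * (K * ρ * K.adjoint)) = trace (K.adjoint * A * K * ρ) := by
  obtain ⟨σ, h1, rfl, h3⟩ := hρ.exists_sqrt
  have e1 := trace_mul_comm (hs_mul_ne_top (A * K) h3) (hs_mul_ne_top' K.adjoint h3)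
  have e2 := trace_mul_comm (hs_mul_ne_top (K.adjoint * A * K) h3) h3
  simp only [mul_assoc] at e1 e2 ⊢
  rw [e1, e2]

theorem summable_trace (A : Op ι) {ρ : Op ι} (hρ : IsPosTraceClass ρ) :
    Summable fun i => inner ℂ (ket i) ((A * ρ) (ket i)) := by
  obtain ⟨σ, -, rfl, h3⟩ := hρ.exists_sqrt
  rw [← mul_assoc]
  exact summable_trace_mul (hs_mul_ne_top A h3) h3

theorem trace_add_mul (A B : Op ι) {ρ : Op ι} (hρ : IsPosTraceClass ρ) :
    trace ((A + B) * ρ) = trace (A * ρ) + trace (B * ρ) := by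
  unfold trace
  rw [← (summable_trace A hρ).tsum_add (summable_trace B hρ)]
  simp [add_mul]

/-- Cyclicity gives tr(R²σ²) = tr((Rσ)†Rσ), a squared Hilbert–Schmidt norm. -/
theorem val_eq_tsum_sqrt {R σ : Op ι} (hR : R.adjoint = R) (hσ : σ.adjoint = σ) (h : hs σ ≠ ∞) :
    0 ≤ (trace (R * R * (σ * σ))).re ∧ val (R * R) (σ * σ) = hs (R * σ) := by
  have h1 : trace (R * R * (σ * σ)) = trace ((R * σ).adjoint * (R * σ)) := by
    have e := trace_mul_comm (hs_mul_ne_top (R * R) h) h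
    rw [← ContinuousLinearMap.star_eq_adjoint] at hR hσ ⊢
    rw [star_mul, hR, hσ]
    simp only [mul_assoc] at e ⊢
    exact e
  have h2 := isPosTraceClass_adjoint_mul_self (hs_mul_ne_top R h)
  rw [val, h1, ofReal_trace h2]
  exact ⟨re_trace_nonneg h2, by simp only [qf_adjoint_mul_self, hs]⟩

theorem re_trace_mul_nonneg {A ρ : Op ι} (hA : 0 ≤ A) (hρ : IsPosTraceClass ρ) :
    0 ≤ (trace (A * ρ)).re := by
  obtain ⟨R, hR, rfl⟩ := exists_sq_eq hA
  obtain ⟨σ, h1, rfl, h3⟩ := hρ.exists_sqrt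
  exact (val_eq_tsum_sqrt hR h1 h3).1

/-- Summing the columns of Rσ keeps `A` intact, so order and sums in the observable pass to the
trace. -/
theorem val_eq_tsum_qf_left {A σ : Op ι} (hA : 0 ≤ A) (hσ : σ.adjoint = σ) (h : hs σ ≠ ∞) :
    val A (σ * σ) = ∑' i, qf A (σ (ket i)) := by
  obtain ⟨R, hR, rfl⟩ := exists_sq_eq hA
  rw [(val_eq_tsum_sqrt hR hσ h).2]
  nth_rw 2 [← hR]
  simp only [qf_adjoint_mul_self, hs, mul_apply_eq_comp]

/-- Summing the columns of (Rσ)† = σR instead keeps `ρ` intact, which serves for sums of states. -/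
theorem val_eq_tsum_qf_right {R ρ : Op ι} (hR : R.adjoint = R) (hρ : IsPosTraceClass ρ) :
    val (R * R) ρ = ∑' i, qf ρ (R (ket i)) := by
  obtain ⟨σ, h1, rfl, h3⟩ := hρ.exists_sqrt
  rw [(val_eq_tsum_sqrt hR h1 h3).2, ← hs_adjoint, ← ContinuousLinearMap.star_eq_adjoint, star_mul,
    ContinuousLinearMap.star_eq_adjoint, ContinuousLinearMap.star_eq_adjoint, hR, h1]
  nth_rw 2 [← h1]
  simp only [qf_adjoint_mul_self, hs, mul_apply_eq_comp]

theorem val_conj (A K : Op ι) {ρ : Op ι} (hρ : IsPosTraceClass ρ) :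
    val A (K * ρ * K.adjoint) = val (K.adjoint * A * K) ρ := by
  rw [val, val, trace_conj A K hρ]

theorem val_one {ρ : Op ι} (hρ : IsPosTraceClass ρ) : val 1 ρ = ∑' i, qf ρ (ket i) := by
  rw [val, one_mul, ofReal_trace hρ]

theorem val_one_ne_top {ρ : Op ι} : val 1 ρ ≠ ∞ := ENNReal.ofReal_ne_top

theorem val_mono {A B ρ : Op ι} (hA : 0 ≤ A) (hAB : A ≤ B) (hρ : IsPosTraceClass ρ) :
    val A ρ ≤ val B ρ := by
  obtain ⟨σ, h1, rfl, h3⟩ := hρ.exists_sqrt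
  rw [val_eq_tsum_qf_left hA h1 h3, val_eq_tsum_qf_left (hA.trans hAB) h1 h3]
  exact ENNReal.tsum_le_tsum fun i => qf_le_of_le hAB _

theorem val_add {A B ρ : Op ι} (hA : 0 ≤ A) (hB : 0 ≤ B) (hρ : IsPosTraceClass ρ) :
    val (A + B) ρ = val A ρ + val B ρ := by
  rw [val, trace_add_mul A B hρ, Complex.add_re,
    ENNReal.ofReal_add (re_trace_mul_nonneg hA hρ) (re_trace_mul_nonneg hB hρ)]
  rfl

/-- ‖σσ‖ ≤ ‖σ‖², which the squared Hilbert–Schmidt norm of σ, namely tr ρ, dominates. Bounds on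
traces thus yield norm summability. -/
theorem enorm_le_val_one {ρ : Op ι} (hρ : IsPosTraceClass ρ) : ‖ρ‖ₑ ≤ val 1 ρ := by
  obtain ⟨σ, h1, rfl, h3⟩ := hρ.exists_sqrt
  rw [val_eq_tsum_qf_left zero_le_one h1 h3]
  simp only [qf_one]
  refine le_trans ?_ (enorm_sq_le_hs σ)
  rw [sq, ← ofReal_norm, ← ofReal_norm, ← ENNReal.ofReal_mul (norm_nonneg _)]
  exact ENNReal.ofReal_le_ofReal (norm_mul_le _ _)

theorem val_le_norm_mul {A ρ : Op ι} (hA : 0 ≤ A) (hρ : IsPosTraceClass ρ) :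
    val A ρ ≤ ‖A‖ₑ * val 1 ρ := by
  obtain ⟨σ, h1, rfl, h3⟩ := hρ.exists_sqrt
  rw [val_eq_tsum_qf_left hA h1 h3, val_eq_tsum_qf_left zero_le_one h1 h3,
    ← ENNReal.tsum_mul_left]
  refine ENNReal.tsum_le_tsum fun i => ?_
  rw [qf_one, qf, ← ofReal_norm A, enorm_sq_eq_ofReal, ← ENNReal.ofReal_mul (norm_nonneg _)]
  refine ENNReal.ofReal_le_ofReal ((Complex.re_le_norm _).trans ?_)
  refine (norm_inner_le_norm _ _).trans ?_
  have := A.le_opNorm (σ (ket i))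
  nlinarith [norm_nonneg (σ (ket i))]

theorem isPartialDensity_iff {ρ : Op ι} : IsPartialDensity ρ ↔ IsPosTraceClass ρ ∧ val 1 ρ ≤ 1 := by
  rw [IsPartialDensity, isPosTraceClass_iff, ← and_assoc, val, one_mul, ENNReal.ofReal_le_one]

end Operators

/-! ### Infinite sums of states and of observables -/

section Sums

theorem hasSum_qf {H α : Type*} [NormedAddCommGroup H] [InnerProductSpace ℂ H]
    {T : α → H →L[ℂ] H} {T' : H →L[ℂ] H} (hT : ∀ a, 0 ≤ T a) (h : HasSum T T') (ψ : H) :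
    qf T' ψ = ∑' a, qf (T a) ψ := by
  have h1 : HasSum (fun a => (inner ℂ ψ (T a ψ)).re) (inner ℂ ψ (T' ψ)).re :=
    Complex.hasSum_re (((h.mapL (ContinuousLinearMap.apply ℂ H ψ)).mapL (innerSL ℂ ψ)))
  simp only [qf]
  rw [← h1.tsum_eq, ENNReal.ofReal_tsum_of_nonneg (fun a => re_inner_nonneg (hT a) ψ) h1.summable]

theorem nonneg_of_hasSum {H α : Type*} [NormedAddCommGroup H] [InnerProductSpace ℂ H]
    {T : α → H →L[ℂ] H} {T' : H →L[ℂ] H} (hT : ∀ a, 0 ≤ T a) (h : HasSum T T') : 0 ≤ T' := by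
  rw [ContinuousLinearMap.nonneg_iff_isPositive, ContinuousLinearMap.isPositive_iff_complex]
  intro ψ
  have h1 : HasSum (fun a => inner ℂ ψ (T a ψ)) (inner ℂ ψ (T' ψ)) :=
    ((h.mapL (ContinuousLinearMap.apply ℂ H ψ)).mapL (innerSL ℂ ψ))
  have h2 := Complex.nonneg_iff.mp (h1.nonneg fun a => inner_nonneg (hT a) ψ)
  rw [← inner_conj_symm (T' ψ) ψ, Complex.conj_eq_iff_im.mpr h2.2.symm]
  exact ⟨Complex.ext rfl h2.2, h2.1⟩

variable {ι α : Type*}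

theorem summable_of_tsum_val {T : α → Op ι} (hT : ∀ a, IsPosTraceClass (T a))
    (h : ∑' a, val 1 (T a) ≠ ∞) : Summable T :=
  Summable.of_enorm (ne_top_of_le_ne_top h (ENNReal.tsum_le_tsum fun a => enorm_le_val_one (hT a)))

theorem isPosTraceClass_tsum {T : α → Op ι} (hT : ∀ a, IsPosTraceClass (T a))
    (h : ∑' a, val 1 (T a) ≠ ∞) : IsPosTraceClass (∑' a, T a) := by
  have hs := (summable_of_tsum_val hT h).hasSum
  refine ⟨nonneg_of_hasSum (fun a => (hT a).1) hs, ?_⟩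
  simp_rw [hasSum_qf (fun a => (hT a).1) hs]
  rw [ENNReal.tsum_comm]
  simpa only [val_one (hT _)] using h

/-- The trace is not norm continuous; norm convergence yields only quadratic forms, and positivity
lets the sum over the basis be exchanged with the one over `α`. -/
theorem val_tsum {T : α → Op ι} (hT : ∀ a, IsPosTraceClass (T a))
    (h : ∑' a, val 1 (T a) ≠ ∞) {A : Op ι} (hA : 0 ≤ A) :
    val A (∑' a, T a) = ∑' a, val A (T a) := by
  have hs := (summable_of_tsum_val hT h).hasSum
  obtain ⟨R, hR, rfl⟩ := exists_sq_eq hA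
  rw [val_eq_tsum_qf_right hR (isPosTraceClass_tsum hT h)]
  simp_rw [hasSum_qf (fun a => (hT a).1) hs, val_eq_tsum_qf_right hR (hT _)]
  exact ENNReal.tsum_comm

/-- The series of the `B a` need not converge in norm. Instead W = V†V, where V maps ψ to the family
(√B_a ψ)_a in ℓ²(α, H); the bound on the forms makes V well defined and bounded. -/
theorem exists_qf_eq_tsum {H : Type*} [NormedAddCommGroup H] [InnerProductSpace ℂ H]
    [CompleteSpace H] {B : α → H →L[ℂ] H} (hB : ∀ a, 0 ≤ B a) {C : ℝ≥0∞} (hC : C ≠ ∞)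
    (h : ∀ ψ, ∑' a, qf (B a) ψ ≤ C * ‖ψ‖ₑ ^ 2) :
    ∃ W : H →L[ℂ] H, 0 ≤ W ∧ ∀ ψ, qf W ψ = ∑' a, qf (B a) ψ := by
  choose R hR hRB using fun a => exists_sq_eq (hB a)
  have hq (a : α) (ψ : H) : qf (B a) ψ = ‖R a ψ‖ₑ ^ 2 := by
    rw [← qf_adjoint_mul_self, hR, hRB]
  simp_rw [hq] at h ⊢
  have hmem (ψ : H) : Memℓp (fun a => R a ψ) 2 := by
    rw [memℓp_gen_iff (by norm_num)]
    simpa using summable_norm_sq (ne_top_of_le_ne_top (ENNReal.mul_ne_top hC (by simp)) (h ψ))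
  let V₀ : H →ₗ[ℂ] lp (fun _ : α => H) 2 :=
    { toFun := fun ψ => ⟨fun a => R a ψ, hmem ψ⟩
      map_add' := fun ψ φ => by
        apply lp.ext
        funext a
        exact map_add (R a) ψ φ
      map_smul' := fun c ψ => by
        apply lp.ext
        funext a
        exact map_smul (R a) c ψ }
  have hV (ψ : H) : ‖V₀ ψ‖ₑ ^ 2 = ∑' a, ‖R a ψ‖ₑ ^ 2 := by
    have h1 := lp.hasSum_norm (p := 2) (by norm_num) (V₀ ψ)
    have h2 : HasSum (fun a => ‖R a ψ‖ ^ 2) (‖V₀ ψ‖ ^ 2) := by simpa [V₀] using h1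
    rw [tsum_enorm_sq h2, enorm_sq_eq_ofReal]
  let V : H →L[ℂ] lp (fun _ : α => H) 2 := V₀.mkContinuous (√C.toReal) fun ψ => by
    refine le_of_sq_le_sq ?_ (by positivity)
    rw [mul_pow, Real.sq_sqrt ENNReal.toReal_nonneg]
    have h1 := h ψ
    rw [← hV] at h1
    simpa using ENNReal.toReal_mono (ENNReal.mul_ne_top hC (by simp)) h1
  refine ⟨V.adjoint ∘L V,
    (ContinuousLinearMap.nonneg_iff_isPositive _).mpr V.isPositive_adjoint_comp_self, fun ψ => ?_⟩
  rw [← hV, qf, enorm_sq_eq_ofReal, ContinuousLinearMap.comp_apply,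
    ContinuousLinearMap.adjoint_inner_right]
  congr 1
  exact inner_self_eq_norm_sq (𝕜 := ℂ) (V ψ)

theorem val_eq_tsum_of_qf {B : α → Op ι} (hB : ∀ a, 0 ≤ B a) {W : Op ι} (hW : 0 ≤ W)
    (h : ∀ ψ, qf W ψ = ∑' a, qf (B a) ψ) {ρ : Op ι} (hρ : IsPosTraceClass ρ) :
    val W ρ = ∑' a, val (B a) ρ := by
  obtain ⟨σ, h1, rfl, h3⟩ := hρ.exists_sqrt
  simp_rw [val_eq_tsum_qf_left (hB _) h1 h3, val_eq_tsum_qf_left hW h1 h3, h]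
  exact ENNReal.tsum_comm

/-- The hypothesis says ∑ K†K ≤ 1 as forms; it is applied to each column of √ρ. -/
theorem tsum_val_conj_le {K : α → Op ι} (hK : ∀ ψ, ∑' a, ‖K a ψ‖ₑ ^ 2 ≤ ‖ψ‖ₑ ^ 2) {ρ : Op ι}
    (hρ : IsPosTraceClass ρ) : ∑' a, val 1 (K a * ρ * (K a).adjoint) ≤ val 1 ρ := by
  simp_rw [val_conj 1 _ hρ, mul_one]
  obtain ⟨σ, h1, rfl, h3⟩ := hρ.exists_sqrt
  simp_rw [val_eq_tsum_qf_left (adjoint_mul_self_nonneg _) h1 h3,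
    val_eq_tsum_qf_left zero_le_one h1 h3, qf_adjoint_mul_self, qf_one]
  rw [ENNReal.tsum_comm]
  exact ENNReal.tsum_le_tsum fun i => hK _

/-! ### Rank one operators -/

theorem trace_mul_rankOne (A : Op ι) (ψ : ℓ²(ι, ℂ)) :
    trace (A * InnerProductSpace.rankOne ℂ ψ ψ) = inner ℂ ψ (A ψ) := by
  have h := lp.hasSum_inner (𝕜 := ℂ) ψ (A ψ)
  rw [← h.tsum_eq, trace]
  refine tsum_congr fun i => ?_
  rw [mul_apply_eq_comp, InnerProductSpace.rankOne_apply, map_smul, inner_smul_right, inner_ket,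
    ← inner_conj_symm, inner_ket, RCLike.inner_apply, mul_comm]

theorem val_rankOne (A : Op ι) (ψ : ℓ²(ι, ℂ)) :
    val A (InnerProductSpace.rankOne ℂ ψ ψ) = qf A ψ := by
  rw [val, trace_mul_rankOne, qf]

theorem qf_rankOne (ψ φ : ℓ²(ι, ℂ)) :
    qf (InnerProductSpace.rankOne ℂ ψ ψ) φ = ‖inner ℂ φ ψ‖ₑ ^ 2 := by
  rw [qf, enorm_sq_eq_ofReal, InnerProductSpace.rankOne_apply, inner_smul_right,
    ← inner_conj_symm, RCLike.conj_mul]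
  congr 1
  norm_cast

theorem isPosTraceClass_rankOne (ψ : ℓ²(ι, ℂ)) :
    IsPosTraceClass (InnerProductSpace.rankOne ℂ ψ ψ : Op ι) := by
  refine ⟨(ContinuousLinearMap.nonneg_iff_isPositive _).mpr
    (InnerProductSpace.isPositive_rankOne_self ψ), ?_⟩
  simp [qf_rankOne, inner_ket, tsum_enorm_sq_apply]

/-- Positive operators are determined by their values on partial density operators. -/
theorem le_of_val_le {A B : Op ι} (hA : 0 ≤ A) (hB : 0 ≤ B)
    (h : ∀ ρ, IsPosTraceClass ρ → val 1 ρ ≤ 1 → val A ρ ≤ val B ρ) : A ≤ B := by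
  refine le_of_qf_le hA hB fun ψ => ?_
  by_cases hψ : ψ = 0
  · simp [hψ, qf]
  -- Only states of trace at most 1 are available, so ψ is normalized; `hsc` undoes the scaling.
  have key := h _ (isPosTraceClass_rankOne ((‖ψ‖⁻¹ : ℂ) • ψ)) (by
    rw [val_rankOne, qf_one, enorm_sq_eq_ofReal, norm_smul]
    simp [hψ])
  have hsc (A : Op ι) : qf A ((‖ψ‖⁻¹ : ℂ) • ψ) = ENNReal.ofReal (‖ψ‖⁻¹ ^ 2) * qf A ψ := by
    rw [qf, qf, ← ENNReal.ofReal_mul (by positivity), map_smul, inner_smul_left, inner_smul_right,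
      ← mul_assoc]
    congr 1
    rw [← Complex.re_ofReal_mul]
    congr 2
    simp [sq]
  rw [val_rankOne, val_rankOne, hsc, hsc] at key
  refine (ENNReal.mul_le_mul_iff_right ?_ ENNReal.ofReal_ne_top).mp key
  simp [hψ]

theorem eq_of_val_eq {A B : Op ι} (hA : 0 ≤ A) (hB : 0 ≤ B)
    (h : ∀ ρ, IsPosTraceClass ρ → val A ρ = val B ρ) : A = B :=
  le_antisymm (le_of_val_le hA hB fun ρ hρ _ => (h ρ hρ).le)
    (le_of_val_le hB hA fun ρ hρ _ => (h ρ hρ).ge)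

end Sums

/-! ### Computation paths -/

section Paths

variable {Var : Type} {ty : Var → QType}

/-- The transitions out of a program, with the state left open. -/
def Branch : Program ty → Type
  | .skip => Unit
  | .init _ => Unit
  | .apply _ _ _ => Unit
  | .seq S₁ _ => Branch S₁
  | .measure (ι := ι) _ _ _ => ι
  | .loop _ _ _ => Bool

/-- The remaining program after a transition. -/
def Branch.next : (S : Program ty) → Branch S → Option (Program ty)
  | .skip, _ => none
  | .init _, _ => none
  | .apply _ _ _, _ => none
  | .seq S₁ S₂, b => andThen (Branch.next S₁ b) S₂
  | .measure _ _ S, m => some (S m)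
  | .loop _ _ _, false => none
  | .loop q M S, true => some (.seq S (.loop q M S))

/-- The effect of a transition on the state. -/
def Branch.act : (S : Program ty) → Branch S → AllOp ty → AllOp ty
  | .skip, _, ρ => ρ
  | .init v, _, ρ => initState v ρ
  | .apply q U _, _, ρ => cylinder q U * ρ * (cylinder q U).adjoint
  | .seq S₁ _, b, ρ => Branch.act S₁ b ρ
  | .measure q M _, m, ρ => cylinder q (M.op m) * ρ * (cylinder q (M.op m)).adjoint
  | .loop q M _, false, ρ => cylinder q (M.op 0) * ρ * (cylinder q (M.op 0)).adjoint
  | .loop q M _, true, ρ => cylinder q (M.op 1) * ρ * (cylinder q (M.op 1)).adjoint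

/-- The transition from a given state along a branch. -/
def Branch.step : (S : Program ty) → (b : Branch S) → (ρ : AllOp ty) →
    Step (some S) ρ (Branch.next S b) (Branch.act S b ρ)
  | .skip, _, ρ => .skip ρ
  | .init v, _, ρ => .init v ρ
  | .apply q U hU, _, ρ => .apply q U hU ρ
  | .seq S₁ S₂, b, ρ => .seq S₁ S₂ _ ρ _ (Branch.step S₁ b ρ)
  | .measure q M S, m, ρ => .measure q M S m ρ
  | .loop q M S, false, ρ => .loop_zero q M S ρ
  | .loop q M S, true, ρ => .loop_one q M S ρ

/-- The transitions out of a configuration, the empty program having none. -/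
def OptBranch : Option (Program ty) → Type
  | none => Empty
  | some S => Branch S

/-- The branch followed by a transition. -/
def Step.branch : {s s' : Option (Program ty)} → {ρ ρ' : AllOp ty} → Step s ρ s' ρ' →
    OptBranch s
  | _, _, _, _, .skip _ => ()
  | _, _, _, _, .init _ _ => ()
  | _, _, _, _, .apply _ _ _ _ => ()
  | _, _, _, _, .seq _ _ _ _ _ h => (Step.branch h :)
  | _, _, _, _, .measure _ _ _ m _ => m
  | _, _, _, _, .loop_zero _ _ _ _ => false
  | _, _, _, _, .loop_one _ _ _ _ => true

theorem branch_step : (S : Program ty) → (b : Branch S) → (ρ : AllOp ty) →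
    (Branch.step S b ρ).branch = b
  | .skip, _, _ => rfl
  | .init _, _, _ => rfl
  | .apply _ _ _, _, _ => rfl
  | .seq S₁ _, b, ρ => branch_step S₁ b ρ
  | .measure _ _ _, _, _ => rfl
  | .loop _ _ _, false, _ => rfl
  | .loop _ _ _, true, _ => rfl

/-- A transition is determined by its source and its branch. The indices are equated explicitly
because both configurations vary in the induction. -/
theorem exists_branch {s s' : Option (Program ty)} {ρ ρ' : AllOp ty} (h : Step s ρ s' ρ') :
    ∃ (S : Program ty) (b : Branch S), s = some S ∧ s' = Branch.next S b ∧
      ρ' = Branch.act S b ρ ∧ h ≍ Branch.step S b ρ := by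
  induction h with
  | skip ρ => exact ⟨.skip, (), rfl, rfl, rfl, .rfl⟩
  | init v ρ => exact ⟨.init v, (), rfl, rfl, rfl, .rfl⟩
  | apply q U hU ρ => exact ⟨.apply q U hU, (), rfl, rfl, rfl, .rfl⟩
  | seq S₁ S₂ S₁' ρ ρ' h ih =>
    obtain ⟨S, b, hS, rfl, rfl, hb⟩ := ih
    cases hS
    cases hb
    exact ⟨.seq S₁ S₂, b, rfl, rfl, rfl, .rfl⟩
  | measure q M S m ρ => exact ⟨.measure q M S, m, rfl, rfl, rfl, .rfl⟩
  | loop_zero q M S ρ => exact ⟨.loop q M S, false, rfl, rfl, rfl, .rfl⟩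
  | loop_one q M S ρ => exact ⟨.loop q M S, true, rfl, rfl, rfl, .rfl⟩

/-- Terminating sequences of branches. -/
inductive Path : Option (Program ty) → Type 1
  | nil : Path none
  | cons {S : Program ty} (b : Branch S) (p : Path (Branch.next S b)) : Path (some S)

namespace Path

/-- The effect of a path on the state. -/
def act : {s : Option (Program ty)} → Path s → AllOp ty → AllOp ty
  | _, nil, ρ => ρ
  | _, cons (S := S) b p, ρ => p.act (Branch.act S b ρ)

/-- The computation from a given state along a path. -/
def run : {s : Option (Program ty)} → (p : Path s) → (ρ : AllOp ty) → Run s ρ none (p.act ρ)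
  | _, nil, ρ => .refl none ρ
  | _, cons (S := S) b p, ρ => .cons (Branch.step S b ρ) (p.run (Branch.act S b ρ))

/-- The list of branches of a path. -/
def code : {s : Option (Program ty)} → Path s → List (Σ s : Option (Program ty), OptBranch s)
  | _, nil => []
  | _, cons (S := S) b p => ⟨some S, b⟩ :: p.code

/-- The length of a path. -/
def length : {s : Option (Program ty)} → Path s → ℕ
  | _, nil => 0
  | _, cons _ p => p.length + 1

/-- The head of the code determines the first branch, hence the type of the remaining path. Codes
are plain lists, so they also compare computations whose types differ. -/
theorem code_injective {s : Option (Program ty)} :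
    Function.Injective (code : Path s → List (Σ s : Option (Program ty), OptBranch s)) := by
  intro p
  induction p with
  | nil => intro p' _; cases p'; rfl
  | cons b p ih =>
    intro p' h
    cases p' with
    | cons b' p' =>
      simp only [code, List.cons.injEq] at h
      obtain ⟨h1, h2⟩ := h
      have hb : b = b' := eq_of_heq (Sigma.mk.inj h1).2
      subst hb
      rw [ih h2]

end Path

/-- The list of branches of a computation. -/
def Run.code : {s s' : Option (Program ty)} → {ρ ρ' : AllOp ty} →
    Run s ρ s' ρ' → List (Σ s : Option (Program ty), OptBranch s)
  | _, _, _, _, .refl _ _ => []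
  | _, _, _, _, .cons (S := s) h t => ⟨s, h.branch⟩ :: t.code

theorem Path.code_run {s : Option (Program ty)} (p : Path s) (ρ : AllOp ty) :
    (p.run ρ).code = p.code := by
  induction p generalizing ρ with
  | nil => rfl
  | cons b p ih =>
    simp only [Path.run, Run.code, Path.code, branch_step]
    exact congrArg _ (ih _)

theorem exists_path {s s' : Option (Program ty)} {ρ ρ' : AllOp ty} (r : Run s ρ s' ρ')
    (hs' : s' = none) : ∃ p : Path s, ρ' = p.act ρ ∧ r ≍ p.run ρ := by
  induction r with
  | refl S ρ => subst hs'; exact ⟨.nil, rfl, .rfl⟩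
  | cons h t ih =>
    obtain ⟨S, b, rfl, rfl, rfl, hb⟩ := exists_branch h
    subst hs'
    obtain ⟨p, rfl, hp⟩ := ih rfl
    cases hb
    cases hp
    exact ⟨.cons b p, rfl, .rfl⟩

/-- Terminating computations from a given state correspond to paths. -/
def pathEquiv (s : Option (Program ty)) (ρ : AllOp ty) :
    Path s ≃ ((ρ' : AllOp ty) × Run s ρ none ρ') :=
  Equiv.ofBijective (fun p => ⟨p.act ρ, p.run ρ⟩) <| by
    refine ⟨fun p p' h => Path.code_injective ?_, ?_⟩
    -- Distinct paths may end in the same state, so they are told apart by their recorded branches.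
    · have := congrArg (fun c : (ρ' : AllOp ty) × Run s ρ none ρ' => c.2.code) h
      simpa only [Path.code_run] using this
    · rintro ⟨ρ', r⟩
      obtain ⟨p, rfl, hp⟩ := exists_path r rfl
      exact ⟨p, by cases hp; rfl⟩

theorem denote_eq_tsum (S : Program ty) (ρ : AllOp ty) :
    denote S ρ = ∑' p : Path (some S), p.act ρ :=
  ((pathEquiv (some S) ρ).tsum_eq fun c => c.1).symm

/-- A nonempty path consists of a branch and a path. -/
def consEquiv (S : Program ty) : (Σ b : Branch S, Path (Branch.next S b)) ≃ Path (some S) :=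
  Equiv.ofBijective (fun c => .cons c.1 c.2) <| by
    refine ⟨fun ⟨b, p⟩ ⟨b', p'⟩ h => ?_, fun p => ?_⟩
    · simp only [Path.cons.injEq] at h
      obtain ⟨rfl, h⟩ := h
      rw [eq_of_heq h]
    · cases p with
      | cons b p => exact ⟨⟨b, p⟩, rfl⟩

namespace Path

/-- Concatenation of paths. -/
def append {S₂ : Program ty} : {s : Option (Program ty)} → Path s → Path (some S₂) →
    Path (andThen s S₂)
  | _, nil, p₂ => p₂
  | _, cons (S := S) b p, p₂ => cons (S := .seq S S₂) b (append p p₂)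

theorem act_append {S₂ : Program ty} {s : Option (Program ty)} (p : Path s) (p₂ : Path (some S₂))
    (ρ : AllOp ty) : (p.append p₂).act ρ = p₂.act (p.act ρ) := by
  induction p generalizing ρ with
  | nil => rfl
  | cons b p ih => exact ih _

/-- The first path ends exactly when its program becomes empty, so the cut is forced. -/
theorem append_injective {S₂ : Program ty} {s : Option (Program ty)} (p p' : Path s)
    (p₂ p₂' : Path (some S₂)) (h : p.append p₂ = p'.append p₂') : p = p' ∧ p₂ = p₂' := by
  induction p with
  | nil => cases p'; exact ⟨rfl, h⟩
  | cons b p ih =>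
    cases p' with
    | cons b' p' =>
      obtain ⟨h1, h2⟩ := Path.cons.inj h
      cases h1
      obtain ⟨h3, h4⟩ := ih p' (eq_of_heq h2)
      rw [h3, h4]
      exact ⟨rfl, rfl⟩

/-- The path is cut where the first component becomes `none`. A free index `t` is needed for the
induction. -/
theorem exists_append {S₂ : Program ty} {t : Option (Program ty)} (r : Path t)
    {s : Option (Program ty)} (ht : t = andThen s S₂) :
    ∃ (p : Path s) (p₂ : Path (some S₂)), r ≍ p.append p₂ := by
  induction r generalizing s with
  | nil => cases s <;> cases ht
  | cons b r ih =>
    cases s with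
    | none =>
      cases ht
      exact ⟨nil, cons b r, .rfl⟩
    | some S₁ =>
      cases ht
      obtain ⟨p, p₂, h⟩ := ih (s := Branch.next S₁ b) rfl
      exact ⟨cons (S := S₁) b p, p₂, by cases h; rfl⟩

/-- A path of `S₁; S₂` consists of a path of `S₁` and one of `S₂`. -/
def appendEquiv (S₁ S₂ : Program ty) :
    Path (some S₁) × Path (some S₂) ≃ Path (some (.seq S₁ S₂)) :=
  Equiv.ofBijective (fun c => c.1.append c.2) <| by
    refine ⟨fun c c' h => Prod.ext_iff.mpr (append_injective _ _ _ _ h), fun r => ?_⟩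
    obtain ⟨p, p₂, h⟩ := exists_append r (s := some S₁) rfl
    exact ⟨(p, p₂), (eq_of_heq h).symm⟩

end Path

end Paths

/-! ### Cylinder extensions -/

section CylinderExtension

variable {Var : Type} {ty : Var → QType} (q : Register Var)

/-- The whole space is the orthogonal sum of copies of the register space, one for each assignment
outside the register, and A ⊗ I acts as A on each copy. -/
theorem slice_cylinder (A : RegOp ty q) (f : AllBasis ty) (ψ : AllSpace ty) :
    slice q f (cylinder q A ψ) = A (slice q f ψ) := by
  apply lp.ext
  funext x
  change A (slice q (overwrite q x f) ψ) (restrict q (overwrite q x f)) = _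
  rw [slice_overwrite, restrict_overwrite]

theorem tsum_enorm_sq_slice (ψ : AllSpace ty) :
    ∑' r : {r : AllBasis ty // restrict q r = 0}, ‖slice q r.1 ψ‖ₑ ^ 2 = ‖ψ‖ₑ ^ 2 := by
  rw [tsum_enorm_sq (hasSum_slice q ψ), enorm_sq_eq_ofReal]

theorem hasSum_inner_slice (ψ φ : AllSpace ty) :
    HasSum (fun r : {r : AllBasis ty // restrict q r = 0} =>
      inner ℂ (slice q r.1 ψ) (slice q r.1 φ)) (inner ℂ ψ φ) :=
  ((splitEquiv q).hasSum_iff.mpr (lp.hasSum_inner (𝕜 := ℂ) ψ φ)).prod_fiberwise fun r =>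
    lp.hasSum_inner (𝕜 := ℂ) (slice q r.1 ψ) (slice q r.1 φ)

theorem cylinder_adjoint (A : RegOp ty q) : (cylinder q A).adjoint = cylinder q A.adjoint := by
  symm
  rw [ContinuousLinearMap.eq_adjoint_iff]
  intro ψ φ
  rw [← (hasSum_inner_slice q _ _).tsum_eq, ← (hasSum_inner_slice q _ _).tsum_eq]
  simp_rw [slice_cylinder, ContinuousLinearMap.adjoint_inner_left]

theorem tsum_enorm_sq_cylinder {α : Type*} {A : α → RegOp ty q}
    (hA : ∀ φ, ∑' a, ‖A a φ‖ₑ ^ 2 = ‖φ‖ₑ ^ 2) (ψ : AllSpace ty) :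
    ∑' a, ‖cylinder q (A a) ψ‖ₑ ^ 2 = ‖ψ‖ₑ ^ 2 := by
  simp_rw [← tsum_enorm_sq_slice q (cylinder q _ ψ), slice_cylinder]
  rw [ENNReal.tsum_comm]
  simp_rw [hA, tsum_enorm_sq_slice]

theorem Measurement.tsum_enorm_sq {κ : Type} (M : Measurement ty q κ) (φ : RegSpace ty q) :
    ∑' m, ‖M.op m φ‖ₑ ^ 2 = ‖φ‖ₑ ^ 2 := by
  have h : HasSum (fun m => (inner ℂ φ ((M.op m).adjoint (M.op m φ))).re) (inner ℂ φ φ).re :=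
    Complex.hasSum_re ((M.complete φ).mapL (innerSL ℂ φ))
  rw [← qf_one, qf, one_apply_eq_self, ← h.tsum_eq,
    ENNReal.ofReal_tsum_of_nonneg (fun m => ?_) h.summable]
  · simp_rw [← qf_adjoint_mul_self]
    rfl
  · exact re_inner_nonneg (adjoint_mul_self_nonneg (M.op m)) φ

theorem enorm_ket {ι : Type*} (i : ι) : ‖(ket i : ℓ²(ι, ℂ))‖ₑ = 1 := by
  classical
  rw [← ofReal_norm, ket, lp.norm_single (by norm_num)]
  simp

theorem ketbra_apply {ι : Type*} (x y : ι) (φ : ℓ²(ι, ℂ)) : ketbra x y φ = φ y • ket x := by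
  rw [← inner_ket]
  rfl

theorem adjoint_ketbra {ι : Type*} (x y : ι) : (ketbra x y).adjoint = ketbra y x := by
  symm
  rw [ContinuousLinearMap.eq_adjoint_iff]
  intro ψ φ
  rw [ketbra_apply, ketbra_apply, inner_smul_left, inner_smul_right, inner_ket, ← inner_conj_symm,
    inner_ket, mul_comm]

theorem tsum_enorm_sq_ketbra {ι : Type*} (x : ι) (φ : ℓ²(ι, ℂ)) :
    ∑' y, ‖ketbra x y φ‖ₑ ^ 2 = ‖φ‖ₑ ^ 2 := by
  simp_rw [ketbra_apply, enorm_smul, enorm_ket, mul_one]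
  exact tsum_enorm_sq_apply φ

end CylinderExtension

/-! ### Quantum operations -/

section Operations

variable {ι : Type*}

/-- Trace-nonincreasing maps of positive trace class operators that have a dual map on positive
bounded operators. -/
structure IsOperation (F : Op ι → Op ι) : Prop where
  isPosTraceClass : ∀ {ρ}, IsPosTraceClass ρ → IsPosTraceClass (F ρ)
  val_one_le : ∀ {ρ}, IsPosTraceClass ρ → val 1 (F ρ) ≤ val 1 ρ
  exists_dual : ∀ {A}, 0 ≤ A → ∃ B, 0 ≤ B ∧ ∀ ρ, IsPosTraceClass ρ → val A (F ρ) = val B ρ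

theorem isOperation_id : IsOperation fun ρ : Op ι => ρ :=
  ⟨fun h => h, fun _ => le_rfl, fun {A} hA => ⟨A, hA, fun _ _ => rfl⟩⟩

theorem IsOperation.comp {F G : Op ι → Op ι} (hG : IsOperation G) (hF : IsOperation F) :
    IsOperation fun ρ => G (F ρ) where
  isPosTraceClass h := hG.isPosTraceClass (hF.isPosTraceClass h)
  val_one_le h := (hG.val_one_le (hF.isPosTraceClass h)).trans (hF.val_one_le h)
  exists_dual hA := by
    obtain ⟨B, hB, h1⟩ := hG.exists_dual hA
    obtain ⟨C, hC, h2⟩ := hF.exists_dual hB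
    exact ⟨C, hC, fun ρ hρ => (h1 _ (hF.isPosTraceClass hρ)).trans (h2 ρ hρ)⟩

theorem isOperation_conj {α : Type*} {K : α → Op ι} (hK : ∀ ψ, ∑' a, ‖K a ψ‖ₑ ^ 2 ≤ ‖ψ‖ₑ ^ 2)
    (a : α) : IsOperation fun ρ => K a * ρ * (K a).adjoint where
  isPosTraceClass h := h.conj (K a)
  val_one_le h := (ENNReal.le_tsum a).trans (tsum_val_conj_le hK h)
  exists_dual hA := ⟨_, conj_nonneg hA (K a), fun _ hρ => val_conj _ _ hρ⟩

theorem tsum_val_ne_top {α : Type*} {T : α → Op ι} {ρ : Op ι}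
    (h : ∑' a, val 1 (T a) ≤ val 1 ρ) : ∑' a, val 1 (T a) ≠ ∞ :=
  ne_top_of_le_ne_top val_one_ne_top h

theorem isOperation_tsum {α : Type*} {F : α → Op ι → Op ι} (hF : ∀ a, IsOperation (F a))
    (h : ∀ ρ, IsPosTraceClass ρ → ∑' a, val 1 (F a ρ) ≤ val 1 ρ) :
    IsOperation fun ρ => ∑' a, F a ρ where
  isPosTraceClass {ρ} hρ :=
    isPosTraceClass_tsum (fun a => (hF a).isPosTraceClass hρ) (tsum_val_ne_top (h ρ hρ))
  val_one_le {ρ} hρ := by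
    rw [val_tsum (fun a => (hF a).isPosTraceClass hρ) (tsum_val_ne_top (h ρ hρ)) zero_le_one]
    exact h ρ hρ
  exists_dual {A} hA := by
    choose B hB hBF using fun a => (hF a).exists_dual hA
    -- Testing the duals on rank one states bounds the sum of their forms by ‖A‖‖ψ‖².
    obtain ⟨W, hW, hWB⟩ := exists_qf_eq_tsum hB (C := ‖A‖ₑ) (by simp) fun ψ => by
      have hψ := isPosTraceClass_rankOne ψ
      simp_rw [← val_rankOne, ← hBF _ _ hψ]
      calc ∑' a, val A (F a (InnerProductSpace.rankOne ℂ ψ ψ))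
          ≤ ∑' a, ‖A‖ₑ * val 1 (F a (InnerProductSpace.rankOne ℂ ψ ψ)) :=
            ENNReal.tsum_le_tsum fun a => val_le_norm_mul hA ((hF a).isPosTraceClass hψ)
        _ ≤ ‖A‖ₑ * val 1 (InnerProductSpace.rankOne ℂ ψ ψ) := by
            rw [ENNReal.tsum_mul_left]
            gcongr
            exact h _ hψ
        _ = ‖A‖ₑ * ‖ψ‖ₑ ^ 2 := by rw [val_rankOne, qf_one]
    refine ⟨W, hW, fun ρ hρ => ?_⟩
    rw [val_tsum (fun a => (hF a).isPosTraceClass hρ) (tsum_val_ne_top (h ρ hρ)) hA,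
      val_eq_tsum_of_qf hB hW hWB hρ]
    exact tsum_congr fun a => hBF a ρ hρ

/-- The dual of a predicate stays below 1 because the operation does not increase the trace. -/
theorem IsOperation.exists_dual_predicate {F : Op ι → Op ι} (hF : IsOperation F) {P : Op ι}
    (hP : IsPredicate P) :
    ∃ W, IsPredicate W ∧ ∀ ρ, IsPosTraceClass ρ → val P (F ρ) = val W ρ := by
  obtain ⟨W, hW, h⟩ := hF.exists_dual hP.1
  refine ⟨W, ⟨hW, le_of_val_le hW zero_le_one fun ρ hρ _ => ?_⟩, h⟩
  rw [← h ρ hρ]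
  exact (val_mono hP.1 hP.2 (hF.isPosTraceClass hρ)).trans (hF.val_one_le hρ)

end Operations

/-! ### Programs as quantum operations -/

section Semantics

variable {Var : Type} {ty : Var → QType}

theorem tsum_enorm_sq_measurement {q : Register Var} {κ : Type} (M : Measurement ty q κ)
    (ψ : AllSpace ty) : ∑' m, ‖cylinder q (M.op m) ψ‖ₑ ^ 2 = ‖ψ‖ₑ ^ 2 :=
  tsum_enorm_sq_cylinder q (Measurement.tsum_enorm_sq q M) ψ

theorem tsum_enorm_sq_apply_unitary {q : Register Var} {U : RegOp ty q} (hU : U.adjoint * U = 1)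
    (ψ : AllSpace ty) : ∑' _ : Unit, ‖cylinder q U ψ‖ₑ ^ 2 = ‖ψ‖ₑ ^ 2 := by
  refine tsum_enorm_sq_cylinder (α := Unit) (A := fun _ => U) q (fun φ => ?_) ψ
  rw [tsum_fintype, Finset.univ_unique, Finset.sum_singleton, ← qf_adjoint_mul_self, hU, qf_one]

theorem isOperation_initState (v : Var) : IsOperation (initState (ty := ty) v) := by
  have h (ψ : AllSpace ty) : ∑' n : RegBasis ty (Register.single v),
      ‖cylinder (Register.single v) (ketbra 0 n) ψ‖ₑ ^ 2 = ‖ψ‖ₑ ^ 2 :=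
    tsum_enorm_sq_cylinder _ (fun φ => tsum_enorm_sq_ketbra 0 φ) ψ
  have := isOperation_tsum (isOperation_conj fun ψ => (h ψ).le)
    fun ρ hρ => tsum_val_conj_le (fun ψ => (h ψ).le) hρ
  simp only [cylinder_adjoint, adjoint_ketbra] at this
  exact this

theorem isOperation_branch : (S : Program ty) → (b : Branch S) → IsOperation (Branch.act S b)
  | .skip, _ => isOperation_id
  | .init v, _ => isOperation_initState v
  | .apply _ _ hU, _ => isOperation_conj (fun ψ => (tsum_enorm_sq_apply_unitary hU ψ).le) ()
  | .seq S₁ _, b => isOperation_branch S₁ b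
  | .measure _ M _, m => isOperation_conj (fun ψ => (tsum_enorm_sq_measurement M ψ).le) m
  | .loop _ M _, false => isOperation_conj (fun ψ => (tsum_enorm_sq_measurement M ψ).le) 0
  | .loop _ M _, true => isOperation_conj (fun ψ => (tsum_enorm_sq_measurement M ψ).le) 1

theorem tsum_unit (f : Unit → ℝ≥0∞) : ∑' u, f u = f () := by
  rw [tsum_fintype, Finset.univ_unique, Finset.sum_singleton]

theorem tsum_branch_le {ρ : AllOp ty} (hρ : IsPosTraceClass ρ) : (S : Program ty) →
    ∑' b : Branch S, val 1 (Branch.act S b ρ) ≤ val 1 ρ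
  | .skip => (tsum_unit _).le
  | .init v => (tsum_unit _).trans_le ((isOperation_initState v).val_one_le hρ)
  | .apply _ _ hU => tsum_val_conj_le (fun ψ => (tsum_enorm_sq_apply_unitary hU ψ).le) hρ
  | .seq S₁ _ => tsum_branch_le hρ S₁
  | .measure _ M _ => tsum_val_conj_le (fun ψ => (tsum_enorm_sq_measurement M ψ).le) hρ
  | .loop q M S => by
    have h := tsum_val_conj_le (fun ψ => (tsum_enorm_sq_measurement M ψ).le) hρ
    rw [tsum_fintype, Fin.sum_univ_two] at h
    exact (tsum_bool _).trans_le h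

theorem isOperation_path {s : Option (Program ty)} (p : Path s) : IsOperation p.act := by
  induction p with
  | nil => exact isOperation_id
  | cons b p ih => exact ih.comp (isOperation_branch _ b)

theorem tsum_path_none (f : Path (ty := ty) none → ℝ≥0∞) : ∑' p, f p = f .nil :=
  tsum_eq_single Path.nil fun p hp => absurd (by cases p; rfl) hp

theorem tsum_path_some {S : Program ty} (f : Path (some S) → ℝ≥0∞) :
    ∑' p, f p = ∑' (b : Branch S) (p : Path (Branch.next S b)), f (.cons b p) := by
  rw [← (consEquiv S).tsum_eq]
  exact ENNReal.tsum_sigma fun b p => f (.cons b p)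

/-- Bounding the length permits induction: the first transition preserves or loses trace in total,
and so do the shorter remainders. -/
theorem tsum_bounded_path_le (n : ℕ) (s : Option (Program ty)) {ρ : AllOp ty}
    (hρ : IsPosTraceClass ρ) :
    ∑' p : Path s, (if p.length ≤ n then val 1 (p.act ρ) else 0) ≤ val 1 ρ := by
  induction n generalizing s ρ with
  | zero =>
    cases s with
    | none => exact (tsum_path_none _).le
    | some S =>
      rw [tsum_path_some]
      simp [Path.length]
  | succ n ih =>
    cases s with
    | none => exact (tsum_path_none _).trans_le (by simp [Path.length, Path.act])
    | some S =>
      rw [tsum_path_some]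
      simp only [Path.length, Path.act, add_le_add_iff_right]
      exact (ENNReal.tsum_le_tsum fun b =>
        ih _ ((isOperation_branch S b).isPosTraceClass hρ)).trans (tsum_branch_le hρ S)

theorem tsum_path_le (s : Option (Program ty)) {ρ : AllOp ty} (hρ : IsPosTraceClass ρ) :
    ∑' p : Path s, val 1 (p.act ρ) ≤ val 1 ρ := by
  rw [ENNReal.tsum_eq_iSup_sum]
  -- A finite set of paths has a maximal length.
  refine iSup_le fun F => le_trans ?_ (tsum_bounded_path_le (F.sup Path.length) s hρ)
  refine le_trans (Finset.sum_le_sum fun p hp => ?_) (ENNReal.sum_le_tsum F)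
  rw [if_pos (Finset.le_sup hp)]

theorem isOperation_denote (S : Program ty) : IsOperation (denote S) := by
  rw [show denote S = fun ρ => ∑' p : Path (some S), p.act ρ from funext (denote_eq_tsum S)]
  exact isOperation_tsum isOperation_path fun ρ hρ => tsum_path_le _ hρ

theorem val_denote (S : Program ty) {A ρ : AllOp ty} (hA : 0 ≤ A) (hρ : IsPosTraceClass ρ) :
    val A (denote S ρ) = ∑' p : Path (some S), val A (p.act ρ) := by
  rw [denote_eq_tsum]
  exact val_tsum (fun p => (isOperation_path p).isPosTraceClass hρ)
    (tsum_val_ne_top (tsum_path_le _ hρ)) hA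

/-- The dual of `S₂` carries ⟦S₂⟧ through the infinite sum over paths of `S₁`, so additivity of ⟦S₂⟧
need not be shown. -/
theorem val_denote_seq (S₁ S₂ : Program ty) {A ρ : AllOp ty} (hA : 0 ≤ A)
    (hρ : IsPosTraceClass ρ) :
    val A (denote (.seq S₁ S₂) ρ) = val A (denote S₂ (denote S₁ ρ)) := by
  obtain ⟨B, hB, h⟩ := (isOperation_denote S₂).exists_dual hA
  rw [h _ ((isOperation_denote S₁).isPosTraceClass hρ), val_denote S₁ hB hρ,
    val_denote _ hA hρ, ← (Path.appendEquiv S₁ S₂).tsum_eq]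
  refine Eq.trans ?_ (ENNReal.tsum_prod
    (f := fun (p : Path (some S₁)) (p₂ : Path (some S₂)) => val A (p₂.act (p.act ρ)))) |>.trans ?_
  · exact tsum_congr fun c => congrArg _ (Path.act_append _ _ _)
  · refine tsum_congr fun p => ?_
    have hp := (isOperation_path p).isPosTraceClass hρ
    rw [← val_denote S₂ hA hp, h _ hp]

theorem val_denote_loop (q : Register Var) (M : Measurement ty q (Fin 2)) (S : Program ty)
    {A ρ : AllOp ty} (hA : 0 ≤ A) (hρ : IsPosTraceClass ρ) :
    val A (denote (.loop q M S) ρ) =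
      val A (cylinder q (M.op 0) * ρ * (cylinder q (M.op 0)).adjoint) +
      val A (denote (.loop q M S)
        (denote S (cylinder q (M.op 1) * ρ * (cylinder q (M.op 1)).adjoint))) := by
  rw [← val_denote_seq S _ hA (hρ.conj _), val_denote _ hA (hρ.conj _), val_denote _ hA hρ,
    tsum_path_some]
  -- Branch `false` exits, leaving only the empty path; branch `true` leaves the paths of `S`
  -- followed by the loop.
  refine (tsum_bool _).trans (congrArg₂ _ ?_ rfl)
  exact tsum_path_none _

/-! ### Weakest preconditions -/

theorem totallyCorrect_iff {S : Program ty} {Q P : AllOp ty} (hP : IsPredicate P) :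
    TotallyCorrect Q S P ↔
      ∀ ρ, IsPosTraceClass ρ → val 1 ρ ≤ 1 → val Q ρ ≤ val P (denote S ρ) := by
  simp only [TotallyCorrect, isPartialDensity_iff, and_imp]
  refine forall₃_congr fun ρ hρ _ => ?_
  rw [val, val, ENNReal.ofReal_le_ofReal_iff
    (re_trace_mul_nonneg hP.1 ((isOperation_denote S).isPosTraceClass hρ))]

theorem IsPredicate.compl {ι : Type*} {P : Op ι} (hP : IsPredicate P) : IsPredicate (1 - P) :=
  ⟨sub_nonneg.mpr hP.2, sub_le_self _ hP.1⟩

theorem re_trace_compl {ι : Type*} (P : Op ι) {ρ : Op ι} (hρ : IsPosTraceClass ρ) :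
    (trace ρ).re = (trace (P * ρ)).re + (trace ((1 - P) * ρ)).re := by
  rw [← Complex.add_re, ← trace_add_mul P (1 - P) hρ, add_sub_cancel, one_mul]

/-- The term tr ρ - tr ⟦S⟧ρ turns both predicates into their complements. -/
theorem partiallyCorrect_iff {S : Program ty} {Q P : AllOp ty} (hQ : IsPredicate Q) :
    PartiallyCorrect Q S P ↔
      ∀ ρ, IsPosTraceClass ρ → val 1 ρ ≤ 1 → val (1 - P) (denote S ρ) ≤ val (1 - Q) ρ := by
  simp only [PartiallyCorrect, isPartialDensity_iff, and_imp]
  refine forall₃_congr fun ρ hρ _ => ?_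
  rw [val, val, ENNReal.ofReal_le_ofReal_iff (re_trace_mul_nonneg hQ.compl.1 hρ),
    re_trace_compl Q hρ, re_trace_compl P ((isOperation_denote S).isPosTraceClass hρ)]
  constructor <;> intro h <;> linarith

/-- The dual satisfies the correctness inequality with equality, so any other valid precondition
lies below it. -/
theorem isWeakestPre_of_val {S : Program ty} {P W : AllOp ty} (hP : IsPredicate P)
    (hW : IsPredicate W) (h : ∀ ρ, IsPosTraceClass ρ → val P (denote S ρ) = val W ρ) :
    IsWeakestPre S P W := by
  refine ⟨⟨hW, (totallyCorrect_iff hP).mpr fun ρ hρ _ => (h ρ hρ).ge⟩, fun Q ⟨hQ, hQS⟩ => ?_⟩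
  refine le_of_val_le hQ.1 hW.1 fun ρ hρ h1 => ?_
  rw [← h ρ hρ]
  exact (totallyCorrect_iff hP).mp hQS ρ hρ h1

theorem isWeakestLiberalPre_of_val {S : Program ty} {P W : AllOp ty}
    (hW : IsPredicate W) (h : ∀ ρ, IsPosTraceClass ρ → val (1 - P) (denote S ρ) = val W ρ) :
    IsWeakestLiberalPre S P (1 - W) := by
  refine ⟨⟨hW.compl, (partiallyCorrect_iff hW.compl).mpr fun ρ hρ _ => ?_⟩,
    fun Q ⟨hQ, hQS⟩ => ?_⟩
  · rw [sub_sub_cancel, h ρ hρ]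
  · refine le_sub_comm.mp (le_of_val_le hW.1 hQ.compl.1 fun ρ hρ h1 => ?_)
    rw [← h ρ hρ]
    exact (partiallyCorrect_iff hQ).mp hQS ρ hρ h1

theorem wp_spec (S : Program ty) {P : AllOp ty} (hP : IsPredicate P) :
    IsWeakestPre S P (wp S P) ∧ IsPredicate (wp S P) ∧
      ∀ ρ, IsPosTraceClass ρ → val P (denote S ρ) = val (wp S P) ρ := by
  obtain ⟨W, hW, h⟩ := (isOperation_denote S).exists_dual_predicate hP
  have h1 := isWeakestPre_of_val hP hW h
  have h2 : IsWeakestPre S P (wp S P) := Classical.epsilon_spec ⟨W, h1⟩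
  rw [h2.unique h1]
  exact ⟨h1, hW, h⟩

theorem wlp_spec (S : Program ty) {P : AllOp ty} (hP : IsPredicate P) :
    IsWeakestLiberalPre S P (wlp S P) ∧ wlp S P = 1 - wp S (1 - P) := by
  obtain ⟨-, hW, h⟩ := wp_spec S hP.compl
  have h1 := isWeakestLiberalPre_of_val hW h
  have h2 : IsWeakestLiberalPre S P (wlp S P) := Classical.epsilon_spec ⟨_, h1⟩
  exact ⟨h2, h2.unique h1⟩

theorem wp_loop (q : Register Var) (M : Measurement ty q (Fin 2)) (S : Program ty)
    {P : AllOp ty} (hP : IsPredicate P) :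
    wp (.loop q M S) P =
      (cylinder q (M.op 0)).adjoint * P * cylinder q (M.op 0) +
      (cylinder q (M.op 1)).adjoint * wp S (wp (.loop q M S) P) * cylinder q (M.op 1) := by
  obtain ⟨-, hW, h⟩ := wp_spec (.loop q M S) hP
  obtain ⟨-, hV, h'⟩ := wp_spec S hW
  have n0 := conj_nonneg hP.1 (cylinder q (M.op 0))
  have n1 := conj_nonneg hV.1 (cylinder q (M.op 1))
  refine eq_of_val_eq hW.1 (add_nonneg n0 n1) fun ρ hρ => ?_
  have h1 := hρ.conj (cylinder q (M.op 1))
  rw [← h ρ hρ, val_denote_loop q M S hP.1 hρ, h _ ((isOperation_denote S).isPosTraceClass h1),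
    h' _ h1, val_conj _ _ hρ, val_conj _ _ hρ, val_add n0 n1 hρ]

theorem measurement_complete (q : Register Var) (M : Measurement ty q (Fin 2)) :
    (cylinder q (M.op 0)).adjoint * cylinder q (M.op 0) +
      (cylinder q (M.op 1)).adjoint * cylinder q (M.op 1) = 1 := by
  have n0 := adjoint_mul_self_nonneg (cylinder q (M.op 0))
  have n1 := adjoint_mul_self_nonneg (cylinder q (M.op 1))
  refine eq_of_qf_eq (add_nonneg n0 n1) zero_le_one fun ψ => ?_
  rw [qf_add n0 n1, qf_adjoint_mul_self, qf_adjoint_mul_self, qf_one,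
    ← tsum_enorm_sq_measurement M ψ, tsum_fintype, Fin.sum_univ_two]

theorem wlp_loop (q : Register Var) (M : Measurement ty q (Fin 2)) (S : Program ty)
    {P : AllOp ty} (hP : IsPredicate P) :
    wlp (.loop q M S) P =
      (cylinder q (M.op 0)).adjoint * P * cylinder q (M.op 0) +
      (cylinder q (M.op 1)).adjoint * wlp S (wlp (.loop q M S) P) * cylinder q (M.op 1) := by
  have hl := wlp_spec (.loop q M S) hP
  have e := wp_loop q M S hP.compl
  have c := measurement_complete q M
  rw [(wlp_spec S hl.1.1.1).2, hl.2, sub_sub_cancel]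
  generalize wp S (wp (.loop q M S) (1 - P)) = V at e ⊢
  rw [e]
  simp only [mul_sub, sub_mul, mul_one]
  -- Completeness replaces 1 by M₀†M₀ + M₁†M₁, after which all terms cancel.
  rw [← c]
  abel

end Semantics

end QWhile

end

theorem mainTheorem7 {Var : Type} [Countable Var] [Infinite Var] (ty : Var → QWhile.QType)
    (q : QWhile.Register Var) (M : QWhile.Measurement ty q (Fin 2)) (S : QWhile.Program ty)
    (P : QWhile.AllOp ty) (hP : QWhile.IsPredicate P) :
    (QWhile.IsWeakestPre (.loop q M S) P (QWhile.wp (.loop q M S) P) ∧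
      QWhile.IsWeakestPre S (QWhile.wp (.loop q M S) P)
        (QWhile.wp S (QWhile.wp (.loop q M S) P)) ∧
      QWhile.wp (.loop q M S) P =
        (QWhile.cylinder q (M.op 0)).adjoint * P * QWhile.cylinder q (M.op 0) +
        (QWhile.cylinder q (M.op 1)).adjoint * QWhile.wp S (QWhile.wp (.loop q M S) P) *
          QWhile.cylinder q (M.op 1)) ∧
    (QWhile.IsWeakestLiberalPre (.loop q M S) P (QWhile.wlp (.loop q M S) P) ∧
      QWhile.IsWeakestLiberalPre S (QWhile.wlp (.loop q M S) P)
        (QWhile.wlp S (QWhile.wlp (.loop q M S) P)) ∧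
      QWhile.wlp (.loop q M S) P =
        (QWhile.cylinder q (M.op 0)).adjoint * P * QWhile.cylinder q (M.op 0) +
        (QWhile.cylinder q (M.op 1)).adjoint * QWhile.wlp S (QWhile.wlp (.loop q M S) P) *
          QWhile.cylinder q (M.op 1)) := by
  have h := QWhile.wp_spec (.loop q M S) hP
  have h' := QWhile.wlp_spec (.loop q M S) hP
  exact ⟨⟨h.1, (QWhile.wp_spec S h.2.1).1, QWhile.wp_loop q M S hP⟩,
    ⟨h'.1, (QWhile.wlp_spec S h'.1.1.1).1, QWhile.wlp_loop q M S hP⟩⟩
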